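/- Let $(R,\mathfrak m)$ be a Cohen–Macaulay (Noetherian) local ring of dimension $d\ge 2$ with infinite residue field, and let $I$ be an $\mathfrak m$-primary ideal. Write $H_I(n)=\lambda(R/I^n)$ ($\lambda$ denotes length) for the Hilbert–Samuel function, and let $P_I\in\mathbb Q[X]$ be the Hilbert–Samuel polynomial, i.e. the (existing and unique) polynomial with $P_I(n)=H_I(n)$ for all $n\gg0$. For an ideal $J$ of a commutative ring let $\widetilde J=\bigcup_{n\ge1}(J^{n+1}:J^n)$ be its Ratliff–Rush closure, and put $\rho(I)=\min\{i\ge1:\widetilde{I^n}=I^n\text{ for all }n\ge i\}$. An element $x\in J$ is superficial for $J$ if there is an integer $c\ge1$ such that $(J^{n+1}:x)\cap J^c=J^n$ for all $n\ge c$; elements $x_1,\dots,x_s\in I$ form a superficial sequence for $I$ if, for each $i$, the image of $x_i$ in $R/(x_1,\dots,x_{i-1})$ is superficial for $I/(x_1,\dots,x_{i-1})$. The Ratliff–Rush filtration of $I$ behaves well mod $x_1,\dots,x_s$ if, with $R_s=R/(x_1,\dots,x_s)$ and $\pi:R\to R_s$ the quotient map, $\pi(\widetilde{I^n})=\widetilde{I^nR_s}$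 for all $n\ge1$. Let $x_1,\dots,x_{d-2}\in I$ be a superficial sequence for $I$ such that the Ratliff–Rush filtration of $I$ behaves well mod $x_1,\dots,x_{d-2}$. Then $$(-1)^{d-i}\,\Delta^i\bigl(P_I(n)-H_I(n)\bigr)\ge 0\qquad\text{for all }0\le i\le d\text{ and all }n\ge\rho(I),$$ where $\Delta f(n)=f(n+1)-f(n)$ and $\Delta^i$ is its $i$-th iterate. -/

import Mathlib

open Filter Polynomial IsLocalRing

/-- A Noetherian local ring is Cohen–Macaulay if its depth equals its Krull dimension, i.e. if
its maximal ideal contains a regular sequence whose length is the dimension of the ring. -/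
def IsCohenMacaulayLocal (R : Type*) [CommRing R] [IsLocalRing R] : Prop :=
  IsNoetherianRing R ∧ ∃ rs : List R, (∀ r ∈ rs, r ∈ maximalIdeal R) ∧
    RingTheory.Sequence.IsRegular R rs ∧ (rs.length : WithBot ℕ∞) = ringKrullDim R

section RatliffRush

variable {R : Type*} [CommRing R]

/-- The Ratliff–Rush closure `⋃_{n ≥ 1} (I ^ (n + 1) : I ^ n)` of an ideal `I`. The ideals
`I ^ (n + 1) : I ^ n` form an increasing chain, so that their supremum is their union
(see `mem_ratliffRush`). -/
def ratliffRush (I : Ideal R) : Ideal R :=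
  ⨆ n : {n : ℕ // 1 ≤ n}, (I ^ (n.1 + 1)).colon (I ^ n.1 : Ideal R)

theorem mem_ratliffRush (I : Ideal R) (a : R) :
    a ∈ ratliffRush I ↔ ∃ n : ℕ, 1 ≤ n ∧ ∀ b ∈ I ^ n, a * b ∈ I ^ (n + 1) := by
  have hmono : Monotone
      (fun n : {n : ℕ // 1 ≤ n} => (I ^ (n.1 + 1)).colon (I ^ n.1 : Ideal R)) := by
    rintro ⟨m, hm⟩ ⟨n, hn⟩ hmn a ha
    obtain ⟨k, rfl⟩ := Nat.exists_eq_add_of_le (show m ≤ n from hmn)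
    rw [Submodule.mem_colon] at ha ⊢
    intro b hb
    have hb' : b ∈ I ^ m * I ^ k := by rw [← pow_add]; exact hb
    have e : I ^ (m + k + 1) = I ^ (m + 1) * I ^ k := by rw [← pow_add]; congr 1; omega
    show a • b ∈ I ^ (m + k + 1)
    rw [e]
    refine Submodule.mul_induction_on hb' (fun u hu v hv => ?_) (fun u v hu hv => ?_)
    · rw [smul_eq_mul, ← mul_assoc]
      exact Ideal.mul_mem_mul (ha u hu) hv
    · rw [smul_add]
      exact add_mem hu hv
  have : Nonempty {n : ℕ // 1 ≤ n} := ⟨⟨1, le_rfl⟩⟩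
  rw [ratliffRush, Submodule.mem_iSup_of_directed _ hmono.directed_le]
  simp [Submodule.mem_colon]

/-- The stability index of the Ratliff–Rush filtration: the least `i ≥ 1` such that `I ^ n` is
Ratliff–Rush closed for all `n ≥ i`. -/
noncomputable def stabilityIndex (I : Ideal R) : ℕ :=
  sInf {i : ℕ | 1 ≤ i ∧ ∀ n ≥ i, ratliffRush (I ^ n) = I ^ n}

/-- `x ∈ I` is superficial for `I` if there is a positive integer `c` such that
`(I ^ (n + 1) : x) ∩ I ^ c = I ^ n` for all `n ≥ c`. -/
def IsSuperficial (I : Ideal R) (x : R) : Prop :=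
  x ∈ I ∧ ∃ c : ℕ, 1 ≤ c ∧ ∀ n ≥ c, (I ^ (n + 1)).colon {x} ⊓ I ^ c = I ^ n

/-- The ideal `(x_1, …, x_i)`, with the sequence indexed from `0`: it is generated by the
`x j` with `j < i`. -/
def initialIdeal {s : ℕ} (x : Fin s → R) (i : ℕ) : Ideal R :=
  Ideal.span {r | ∃ j : Fin s, (j : ℕ) < i ∧ x j = r}

/-- `x_1, …, x_s` is a superficial sequence for `I`: the elements lie in `I`, and the image of
each `x_i` in `R / (x_1, …, x_{i-1})` is superficial for `I / (x_1, …, x_{i-1})`. -/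
def IsSuperficialSequence (I : Ideal R) {s : ℕ} (x : Fin s → R) : Prop :=
  ∀ i : Fin s, x i ∈ I ∧
    IsSuperficial (I.map (Ideal.Quotient.mk (initialIdeal x i)))
      (Ideal.Quotient.mk (initialIdeal x i) (x i))

/-- The Ratliff–Rush filtration of `I` behaves well mod `x_1, …, x_s`: for all `n ≥ 1`, the image
of the Ratliff–Rush closure of `I ^ n` in `R_s = R / (x_1, …, x_s)` is the Ratliff–Rush closure of
`I ^ n R_s`. -/
def RatliffRushBehavesWell (I : Ideal R) {s : ℕ} (x : Fin s → R) : Prop :=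
  ∀ n : ℕ, 1 ≤ n →
    (ratliffRush (I ^ n)).map (Ideal.Quotient.mk (initialIdeal x s)) =
      ratliffRush ((I ^ n).map (Ideal.Quotient.mk (initialIdeal x s)))

end RatliffRush

section HilbertSamuel

variable {R : Type*} [CommRing R]

/-- The Hilbert–Samuel function `n ↦ λ(R / I ^ n)`; the length is finite if `R` is a Noetherian
local ring and `I` is primary to the maximal ideal. -/
noncomputable def hilbertSamuel (I : Ideal R) (n : ℕ) : ℕ :=
  (Module.length R (R ⧸ I ^ n)).toNat

/-- `P` takes the same values as the Hilbert–Samuel function of `I` at all large integers. -/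
def IsHilbertSamuelPoly (I : Ideal R) (P : ℚ[X]) : Prop :=
  ∀ᶠ n : ℕ in atTop, P.eval (n : ℚ) = (hilbertSamuel I n : ℚ)

/-- The Hilbert–Samuel polynomial of `I`: the polynomial with `IsHilbertSamuelPoly I P`, which is
unique by `IsHilbertSamuelPoly.eq` (with the value `0` if there is none). -/
noncomputable def hilbertSamuelPoly (I : Ideal R) : ℚ[X] :=
  open Classical in if h : ∃ P, IsHilbertSamuelPoly I P then h.choose else 0

theorem IsHilbertSamuelPoly.eq {I : Ideal R} {P : ℚ[X]} (h : IsHilbertSamuelPoly I P) :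
    hilbertSamuelPoly I = P := by
  have hex : ∃ P, IsHilbertSamuelPoly I P := ⟨P, h⟩
  rw [hilbertSamuelPoly, dif_pos hex]
  have h2 := hex.choose_spec
  obtain ⟨N, hN⟩ := eventually_atTop.1 (h.and h2)
  refine Polynomial.eq_of_infinite_eval_eq _ _
    (((Set.Ici_infinite N).image (Nat.cast_injective (R := ℚ)).injOn).mono ?_)
  rintro _ ⟨n, hn, rfl⟩
  exact (hN n hn).2.trans (hN n hn).1.symm

end HilbertSamuel

/-!
Since `R` is Cohen–Macaulay and its residue field is infinite, the given sequence extends to a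
superficial sequence `x₁, …, x_d` for `I`, which is regular. As the Ratliff–Rush filtration behaves
well mod `x₁, …, x_{d-2}`, the element `x_{d-1}` is regular on its associated graded ring mod
`x₁, …, x_{d-2}`, and Sally's descent makes `x₁, …, x_{d-1}` a regular sequence on the associated
graded ring. So `Δ^{d-1}` of `n ↦ λ(R / (Iⁿ)~)` is, up to a shift, the colength of the image of the
filtration in the one-dimensional ring `R / (x₁, …, x_{d-1})`. The increments of that colength are
at most `e = λ(R / (x₁, …, x_d))`, with equality for large `n`. Since `(Iⁿ)~ = Iⁿ` for `n ≥ ρ(I)`,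
this gives `Δ^d (P_I - H_I) = e - Δ^d H_I ≥ 0` there. The lower differences follow by descending
induction, because each `Δ^i (P_I - H_I)` vanishes eventually and is monotone or antitone according
to the sign of `Δ^{i+1} (P_I - H_I)`.
-/

section Grade

open scoped Pointwise

universe u

variable {R : Type u} [CommRing R] {M : Type u} [AddCommGroup M] [Module R M]

/-- The grade of the ideal `I` on the module `M` is at least `n`, witnessed by an `M`-regular
sequence of length `n` in `I`. -/
def HasGradeGE (I : Ideal R) (M : Type u) [AddCommGroup M] [Module R M] (n : ℕ) : Prop :=
  ∃ rs : List R, rs.length = n ∧ (∀ r ∈ rs, r ∈ I) ∧ RingTheory.Sequence.IsRegular M rs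

theorem HasGradeGE.exists_isSMulRegular {I : Ideal R} {n : ℕ} (h : HasGradeGE I M (n + 1)) :
    ∃ r ∈ I, IsSMulRegular M r := by
  obtain ⟨_ | ⟨r, rs⟩, hlen, hmem, hreg⟩ := h
  · simp at hlen
  · exact ⟨r, hmem r List.mem_cons_self, ((RingTheory.Sequence.isRegular_cons_iff M r rs).1 hreg).1⟩

theorem HasGradeGE.congr {M' : Type u} [AddCommGroup M'] [Module R M'] (e : M ≃ₗ[R] M')
    {I : Ideal R} {n : ℕ} (h : HasGradeGE I M n) : HasGradeGE I M' n :=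
  h.imp fun rs => And.imp_right <| And.imp_right (e.isRegular_congr rs).1

theorem smul_top_quotSMulTop_ne_top {I : Ideal R} {x : R} (hx : x ∈ I)
    (hI : I • (⊤ : Submodule R M) ≠ ⊤) : I • (⊤ : Submodule R (QuotSMulTop x M)) ≠ ⊤ := by
  intro htop
  have hle : x • (⊤ : Submodule R M) ≤ I • ⊤ := by
    rw [← Submodule.ideal_span_singleton_smul]
    exact Submodule.smul_mono_left ((Ideal.span_singleton_le_iff_mem I).2 hx)
  apply hI
  simpa [Submodule.comap_smul_top_of_surjective I _ (Submodule.mkQ_surjective _), hle]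
    using congrArg (Submodule.comap (Submodule.mkQ _)) htop

section Rees

open CategoryTheory Abelian

variable [IsNoetherianRing R] [Module.Finite R M] {I : Ideal R}

theorem HasGradeGE.subsingleton_ext {n : ℕ} (hI : I • (⊤ : Submodule R M) ≠ ⊤)
    (h : HasGradeGE I M n) {N : ModuleCat.{u} R} [Module.Finite R N]
    (hN : Module.support R N ⊆ PrimeSpectrum.zeroLocus I) {i : ℕ} (hi : i < n) :
    Subsingleton (Ext N (ModuleCat.of R M) i) := by
  obtain ⟨rs, rfl, hmem, hreg⟩ := h
  exact ModuleCat.subsingleton_ext_of_exists_isRegular I N hN (.of R M) hI.lt_top rs hmem hreg i hi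

theorem HasGradeGE.of_le_radical {J : Ideal R} {n : ℕ} (hIJ : I ≤ J.radical)
    (hI : I • (⊤ : Submodule R M) ≠ ⊤) (hJ : J • (⊤ : Submodule R M) ≠ ⊤)
    (h : HasGradeGE I M n) : HasGradeGE J M n := by
  have hsupp : Module.support R (R ⧸ J) = PrimeSpectrum.zeroLocus J := by
    rw [Module.support_eq_zeroLocus, Ideal.annihilator_quotient]
  refine ModuleCat.exists_isRegular_of_exists_subsingleton_ext J n (.of R M) hJ.lt_top
    (.of R (R ⧸ J)) hsupp fun i hi => h.subsingleton_ext hI ?_ hi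
  exact hsupp.trans_subset ((PrimeSpectrum.zeroLocus_subset_zeroLocus_iff _ _).2 hIJ)

theorem HasGradeGE.quotSMulTop {x : R} (hxI : x ∈ I) (hx : IsSMulRegular M x)
    (hI : I • (⊤ : Submodule R M) ≠ ⊤) {n : ℕ} (h : HasGradeGE I M (n + 1)) :
    HasGradeGE I (QuotSMulTop x M) n := by
  have hsupp : Module.support R (R ⧸ I) = PrimeSpectrum.zeroLocus I := by
    rw [Module.support_eq_zeroLocus, Ideal.annihilator_quotient]
  refine ModuleCat.exists_isRegular_of_exists_subsingleton_ext I n (.of R (QuotSMulTop x M))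
    (smul_top_quotSMulTop_ne_top hxI hI).lt_top (.of R (R ⧸ I)) hsupp fun i hi => ?_
  have hExt (j : ℕ) (hj : j < n + 1) :=
    AddCommGrpCat.isZero_of_iff_subsingleton.2
      (h.subsingleton_ext hI (N := .of R (R ⧸ I)) hsupp.subset hj)
  have hx' : IsSMulRegular (ModuleCat.of R M) x := hx
  exact AddCommGrpCat.subsingleton_of_isZero <| ShortComplex.Exact.isZero_of_both_zeros
    (Ext.covariant_sequence_exact₃' (.of R (R ⧸ I)) hx'.smulShortComplex_shortExact i (i + 1) rfl)
    ((hExt i (by omega)).eq_zero_of_src _) ((hExt (i + 1) (by omega)).eq_zero_of_tgt _)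

end Rees

theorem mk_mem_map_pow_iff {I K : Ideal R} {n : ℕ} {a : R} :
    Ideal.Quotient.mk K a ∈ I.map (Ideal.Quotient.mk K) ^ n ↔ a ∈ I ^ n ⊔ K := by
  rw [← Ideal.map_pow, ← Ideal.mem_comap,
    Ideal.comap_map_of_surjective' _ Ideal.Quotient.mk_surjective, Ideal.mk_ker]

theorem smul_top_quotient_ne_top {I K : Ideal R} (hKI : K ≤ I) (hI : I ≠ ⊤) :
    I • (⊤ : Submodule R (R ⧸ K)) ≠ ⊤ := by
  intro htop
  have h : (1 : R ⧸ K) ∈ I • (⊤ : Submodule R (R ⧸ K)) := by simp [htop]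
  rw [Ideal.smul_top_eq_map, Submodule.restrictScalars_mem] at h
  apply hI
  rw [Ideal.eq_top_iff_one, ← sup_eq_left.2 hKI, ← pow_one I]
  exact mk_mem_map_pow_iff.1 (by simpa using h)

/-- The identification `(R ⧸ K) ⧸ x(R ⧸ K) ≃ R ⧸ (K + (x))` of a quotient of `R ⧸ K` with a cyclic
module. -/
noncomputable def quotSMulTopQuotientEquiv (K : Ideal R) (x : R) :
    QuotSMulTop x (R ⧸ K) ≃ₗ[R] R ⧸ (K ⊔ Ideal.span {x}) :=
  Submodule.quotEquivOfEq _ _ (by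
      rw [← Submodule.ideal_span_singleton_smul, ← Submodule.range_mkQ K, ← Submodule.map_top,
        ← Submodule.map_smul'', smul_eq_mul, Ideal.mul_top]) |>.trans
    (Submodule.quotientQuotientEquivQuotientSup K (Ideal.span {x}))

theorem HasGradeGE.quotient_sup_span [IsNoetherianRing R] {I K : Ideal R} (hKI : K ≤ I)
    (hI : I ≠ ⊤) {x : R} (hxI : x ∈ I) (hx : IsSMulRegular (R ⧸ K) x) {n : ℕ}
    (h : HasGradeGE I (R ⧸ K) (n + 1)) : HasGradeGE I (R ⧸ (K ⊔ Ideal.span {x})) n :=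
  (h.quotSMulTop hxI hx (smul_top_quotient_ne_top hKI hI)).congr (quotSMulTopQuotientEquiv K x)

theorem ringKrullDim_quotient_sup_span_add_one [IsNoetherianRing R] [IsLocalRing R] {K : Ideal R}
    {x : R} (hxm : x ∈ maximalIdeal R) (hx : IsSMulRegular (R ⧸ K) x) :
    ringKrullDim (R ⧸ (K ⊔ Ideal.span {x})) + 1 = ringKrullDim (R ⧸ K) := by
  rw [← Module.supportDim_quotient_eq_ringKrullDim, ← Module.supportDim_quotient_eq_ringKrullDim,
    ← Module.supportDim_eq_of_equiv (quotSMulTopQuotientEquiv K x)]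
  exact Module.supportDim_quotSMulTop_succ_eq_supportDim hx hxm

theorem IsCohenMacaulayLocal.hasGradeGE [IsLocalRing R] (hR : IsCohenMacaulayLocal R) {d : ℕ}
    (hdim : ringKrullDim R = d) {I : Ideal R} (hI : I.radical = maximalIdeal R) :
    HasGradeGE I R d := by
  obtain ⟨_, rs, hmem, hreg, hlen⟩ := hR
  rw [hdim] at hlen
  have hmax := Ideal.IsPrime.ne_top' (I := maximalIdeal R)
  refine HasGradeGE.of_le_radical hI.ge ?_ ?_ ⟨rs, mod_cast hlen, hmem, hreg⟩
  · simpa using hmax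
  · simpa [← Ideal.radical_eq_top, hI] using hmax

end Grade

section GenericElement

variable {R : Type*} [CommRing R]

theorem infinite_of_nontrivial_of_infinite_residueField [IsLocalRing R]
    [Infinite (ResidueField R)] (M : Type*) [AddCommGroup M] [Module R M] [Nontrivial M] :
    Infinite M := by
  obtain ⟨v, hv⟩ := exists_ne (0 : M)
  let 𝔞 := LinearMap.ker (LinearMap.toSpanSingleton R M v)
  have h𝔞 : 𝔞 ≤ maximalIdeal R :=
    le_maximalIdeal fun htop => hv (by simpa [𝔞] using (Ideal.eq_top_iff_one 𝔞).1 htop)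
  have : Infinite (R ⧸ 𝔞) :=
    Infinite.of_surjective (β := ResidueField R) _ (Ideal.Quotient.factor_surjective h𝔞)
  exact Infinite.of_injective _ (LinearMap.ker_eq_bot.1
    (Submodule.ker_liftQ_eq_bot 𝔞 (LinearMap.toSpanSingleton R M v) le_rfl le_rfl))

theorem exists_forall_notMem_of_infinite_residueField [IsLocalRing R]
    [Infinite (ResidueField R)] {M : Type*} [AddCommGroup M] [Module R M] {ι : Type*}
    {s : Set ι} (hs : s.Finite) (p : ι → Submodule R M) (hp : ∀ i ∈ s, p i ≠ ⊤) :
    ∃ m : M, ∀ i ∈ s, m ∉ p i := by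
  by_contra! hcon
  obtain ⟨t, rfl⟩ := hs.exists_finset_coe
  have hcov : ⋃ i ∈ t, (p i : Set M) = Set.univ :=
    Set.eq_univ_of_forall fun m => by simpa using hcon m
  obtain ⟨k, hk, hfi⟩ := Submodule.exists_finiteIndex_of_cover hcov
  have : Finite (M ⧸ p k) := AddSubgroup.finite_quotient_of_finiteIndex
  have : Nontrivial (M ⧸ p k) := Submodule.Quotient.nontrivial_iff.2 (hp k hk)
  exact (infinite_of_nontrivial_of_infinite_residueField (R := R) (M ⧸ p k)).not_finite ‹_›

theorem exists_pow_smul_inf_ker_lsmul_eq_bot [IsNoetherianRing R] {M : Type*} [AddCommGroup M]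
    [Module R M] [Module.Finite R M] (T : Ideal R) (r : R)
    (hr : ∀ P ∈ associatedPrimes R M, r ∈ P → T ≤ P) :
    ∃ k : ℕ, T ^ k • ⊤ ⊓ LinearMap.ker (LinearMap.lsmul R M r) = ⊥ := by
  set N := LinearMap.ker (LinearMap.lsmul R M r)
  have hT : T ≤ (Module.annihilator R N).radical := by
    rw [← Ideal.sInf_minimalPrimes]
    refine le_sInf fun P hP => hr P (associatedPrimes.subset_of_injective N.injective_subtype
      (Module.associatedPrimes.minimalPrimes_annihilator_subset_associatedPrimes R N hP)) ?_
    exact hP.1.2 (Module.mem_annihilator.2 fun n => Subtype.ext n.2)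
  obtain ⟨n, hn⟩ := Ideal.exists_pow_le_of_le_radical_of_fg hT (IsNoetherian.noetherian T)
  obtain ⟨m, hm⟩ := Ideal.exists_pow_inf_eq_pow_smul T N
  refine ⟨m + n, ?_⟩
  rw [hm _ (Nat.le_add_right m n), Nat.add_sub_cancel_left, eq_bot_iff]
  refine (Submodule.smul_mono hn inf_le_right).trans (Submodule.smul_le.2 fun a ha v hv => ?_)
  simpa using congrArg Subtype.val (Module.mem_annihilator.1 ha ⟨v, hv⟩)

theorem exists_pow_forall_mul_mem_imp [IsNoetherianRing R] (𝔞 T : Ideal R) (r : R)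
    (hr : ∀ P ∈ associatedPrimes R (R ⧸ 𝔞), r ∈ P → T ≤ P) :
    ∃ k : ℕ, ∀ a ∈ T ^ k, r * a ∈ 𝔞 → a ∈ 𝔞 := by
  obtain ⟨k, hk⟩ := exists_pow_smul_inf_ker_lsmul_eq_bot T r hr
  refine ⟨k, fun a ha hra => Ideal.Quotient.eq_zero_iff_mem.1 (hk.le ⟨?_, ?_⟩)⟩
  · have h := Submodule.smul_mem_smul ha (Submodule.mem_top (x := (1 : R ⧸ 𝔞)))
    rwa [Algebra.smul_def, mul_one] at h
  · exact Ideal.Quotient.eq_zero_iff_mem.2 hra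

end GenericElement

section Superficial

variable {A : Type*} [CommRing A] (I : Ideal A)

/-- The map `a ↦ a tⁿ` onto the degree `n` part of the Rees algebra `⨁ Iⁿ tⁿ`. -/
noncomputable def reesMonomial (n : ℕ) : ↥(I ^ n) →ₗ[A] reesAlgebra I where
  toFun a := ⟨monomial n (a : A), reesAlgebra.monomial_mem.2 a.2⟩
  map_add' a b := Subtype.ext (by simp)
  map_smul' r a := Subtype.ext (by simp [smul_monomial])

/-- The kernel `⨁ Iⁿ⁺¹ tⁿ` of the projection from the Rees algebra to the associated graded
ring. -/
noncomputable def reesGradedKernel : Ideal (reesAlgebra I) where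
  carrier := {f | ∀ i, (f : A[X]).coeff i ∈ I ^ (i + 1)}
  zero_mem' := fun i => by simp
  add_mem' := fun hf hg i => by
    rw [Subalgebra.coe_add, coeff_add]
    exact add_mem (hf i) (hg i)
  smul_mem' := fun f g hg i => by
    rw [smul_eq_mul, Subalgebra.coe_mul, coeff_mul]
    refine sum_mem fun p hp => ?_
    rw [← Finset.HasAntidiagonal.mem_antidiagonal.1 hp, add_assoc, pow_add]
    exact Ideal.mul_mem_mul ((mem_reesAlgebra_iff I _).1 f.2 _) (hg _)

/-- The ideal of the Rees algebra generated by its elements of degree one. -/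
noncomputable def reesIrrelevant : Ideal (reesAlgebra I) :=
  Ideal.span (Set.range (reesMonomial I 1))

variable {I}

theorem reesMonomial_one_mul_reesMonomial {n : ℕ} (a : ↥(I ^ 1)) (b : ↥(I ^ n)) :
    reesMonomial I 1 a * reesMonomial I n b =
      reesMonomial I (n + 1) ⟨a * b, by
        simpa [pow_succ'] using Ideal.mul_mem_mul a.2 b.2⟩ :=
  Subtype.ext (by simp [reesMonomial, monomial_mul_monomial, add_comm])

theorem reesMonomial_mem_gradedKernel_iff {n : ℕ} {a : ↥(I ^ n)} :
    reesMonomial I n a ∈ reesGradedKernel I ↔ (a : A) ∈ I ^ (n + 1) := by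
  refine ⟨fun h => by simpa [reesMonomial] using h n, fun h i => ?_⟩
  rcases eq_or_ne n i with rfl | hi
  · simpa [reesMonomial] using h
  · simp [reesMonomial, coeff_monomial, hi]

theorem reesMonomial_mem_pow {n : ℕ} (a : ↥(I ^ n)) :
    reesMonomial I n a ∈ reesIrrelevant I ^ n := by
  obtain ⟨a, ha⟩ := a
  induction ha using Submodule.pow_induction_on_left' with
  | algebraMap r => simp
  | add a b n ha hb iha ihb => exact map_add (reesMonomial I n) ⟨a, ha⟩ ⟨b, hb⟩ ▸ add_mem iha ihb
  | mem_mul a ha n b hb ih =>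
    have hab := reesMonomial_one_mul_reesMonomial ⟨a, (pow_one I).symm ▸ ha⟩ ⟨b, hb⟩
    rw [← hab, Nat.succ_eq_add_one, pow_succ']
    exact Ideal.mul_mem_mul (Ideal.subset_span (Set.mem_range_self _)) ih

theorem isSuperficial_iff {x : A} :
    IsSuperficial I x ↔
      x ∈ I ∧ ∃ c : ℕ, ∀ n ≥ c, ∀ a ∈ I ^ c, x * a ∈ I ^ (n + 1) → a ∈ I ^ n := by
  have hcolon {a : A} {n : ℕ} : a ∈ (I ^ n).colon {x} ↔ x * a ∈ I ^ n := by
    rw [Submodule.mem_colon_singleton, smul_eq_mul, mul_comm]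
  refine and_congr_right fun hx => ⟨?_, ?_⟩
  · rintro ⟨c, -, hc⟩
    exact ⟨c, fun n hn a ha hxa => hc n hn ▸ ⟨hcolon.2 hxa, ha⟩⟩
  · rintro ⟨c, hc⟩
    refine ⟨c + 1, by omega, fun n hn => le_antisymm ?_ (le_inf ?_ (Ideal.pow_le_pow_right hn))⟩
    · exact fun a ⟨hxa, ha⟩ =>
        hc n (by omega) a (Ideal.pow_le_pow_right c.le_succ ha) (hcolon.1 hxa)
    · exact fun a ha => hcolon.2 (pow_succ' I n ▸ Ideal.mul_mem_mul hx ha)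

/-- `x` is chosen so that `x t` avoids the associated primes of the graded ring which do not
contain its irrelevant ideal. -/
theorem exists_isSuperficial [IsNoetherianRing A] [IsLocalRing A] [Infinite (ResidueField A)]
    (I : Ideal A) : ∃ x, IsSuperficial I x := by
  have hproper : ∀ P ∈ associatedPrimes (reesAlgebra I) (reesAlgebra I ⧸ reesGradedKernel I) ∩
      {P | ¬ reesIrrelevant I ≤ P}, (P.restrictScalars A).comap (reesMonomial I 1) ≠ ⊤ := by
    rintro P ⟨-, hP⟩ htop
    refine hP (Ideal.span_le.2 ?_)
    rintro _ ⟨a, rfl⟩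
    exact Submodule.mem_comap.1 (htop ▸ Submodule.mem_top : a ∈ Submodule.comap _ _)
  obtain ⟨x, hx⟩ := exists_forall_notMem_of_infinite_residueField
    ((associatedPrimes.finite _ _).inter_of_left _) _ hproper
  obtain ⟨k, hk⟩ := exists_pow_forall_mul_mem_imp (reesGradedKernel I) (reesIrrelevant I)
    (reesMonomial I 1 x)
    fun P hP hxP => by_contra fun hcon => hx P ⟨hP, hcon⟩ hxP
  refine ⟨x, isSuperficial_iff.2 ⟨by simpa using x.2, k, fun n hn a ha hxa => ?_⟩⟩
  induction n, hn using Nat.le_induction with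
  | base => exact ha
  | succ n hn ih =>
    have han : a ∈ I ^ n := ih (Ideal.pow_le_pow_right n.succ.le_succ hxa)
    let f := reesMonomial I n ⟨a, han⟩
    have hf : f ∈ reesIrrelevant I ^ k :=
      Ideal.pow_le_pow_right hn (reesMonomial_mem_pow ⟨a, han⟩)
    have hxf : reesMonomial I 1 x * f ∈ reesGradedKernel I := by
      rw [reesMonomial_one_mul_reesMonomial, reesMonomial_mem_gradedKernel_iff]
      exact hxa
    exact reesMonomial_mem_gradedKernel_iff.1 (hk f hf hxf)

end Superficial

section Filtration

variable {R : Type*} [CommRing R] {I : Ideal R}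

/-- The filtration `n ↦ Iⁿ` of the ring. -/
def adicFiltration (I : Ideal R) : I.Filtration R where
  N n := I ^ n
  mono n := Ideal.pow_le_pow_right n.le_succ
  smul_le n := (pow_succ' I n).ge

/-- The image of the filtration `F` in `R ⧸ K`, encoded by the ideals `F.N n ⊔ K` of `R`. -/
def modFiltration (F : I.Filtration R) (K : Ideal R) : I.Filtration R :=
  F ⊔ I.trivialFiltration K

/-- Multiplication by (the degree-one initial form of) `x` is injective on the associated graded
ring of `F` in degrees at least `N`; for `N = 0` this says that `x` is regular on it. -/
def IsGrRegularFrom (F : I.Filtration R) (x : R) (N : ℕ) : Prop :=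
  ∀ n ≥ N, ∀ a, x * a ∈ F.N (n + 1) → a ∈ F.N n

theorem modFiltration_sup (F : I.Filtration R) (K L : Ideal R) :
    modFiltration F (K ⊔ L) = modFiltration (modFiltration F K) L :=
  Ideal.Filtration.ext (funext fun _ => (sup_assoc _ K L).symm)

theorem pow_mul_mem_filtration (F : I.Filtration R) {x a : R} {n : ℕ} (hx : x ∈ I)
    (ha : a ∈ F.N n) (j : ℕ) : x ^ j * a ∈ F.N (n + j) := by
  rw [add_comm]
  exact F.pow_smul_le j n (Submodule.smul_mem_smul (Ideal.pow_mem_pow hx j) ha)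

theorem IsGrRegularFrom.mem_of_pow_mul_mem {F : I.Filtration R} {x : R} {N : ℕ}
    (h : IsGrRegularFrom F x N) {n : ℕ} (hn : N ≤ n) {j : ℕ} {a : R}
    (ha : x ^ j * a ∈ F.N (n + j)) : a ∈ F.N n := by
  induction j with
  | zero => simpa using ha
  | succ j ih =>
    refine ih (h (n + j) (by omega) _ ?_)
    rwa [← mul_assoc, ← pow_succ']

theorem isGrRegularFrom_adicFiltration_map_iff {K : Ideal R} {x : R} {N : ℕ} :
    IsGrRegularFrom (adicFiltration (I.map (Ideal.Quotient.mk K))) (Ideal.Quotient.mk K x) N ↔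
      IsGrRegularFrom (modFiltration (adicFiltration I) K) x N := by
  simp only [IsGrRegularFrom, Ideal.Quotient.mk_surjective.forall, ← map_mul]
  exact forall₂_congr fun n _ => forall_congr' fun a =>
    imp_congr mk_mem_map_pow_iff mk_mem_map_pow_iff

/-- Sally's descent: regularity on the graded ring of `F` modulo `x` forces `x` itself to be
regular on the graded ring of `F`. If `x ^ j * a ∈ F.N (n + 1 + j)`, then
`y ^ N * a ∈ F.N (n + 1 + N)`, so that `a` lies in `F.N (n + 1) + (x)`, and the coefficient of `x`
is dealt with in lower degree. -/
theorem IsGrRegularFrom.of_modFiltration_span {F : I.Filtration R} (h0 : F.N 0 = ⊤) {x y : R}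
    (hx : x ∈ I) (hy : y ∈ I) {N : ℕ} (hxN : IsGrRegularFrom F x N)
    (hyx : IsGrRegularFrom (modFiltration F (Ideal.span {x})) y 0) : IsGrRegularFrom F x 0 := by
  suffices main : ∀ n j a, x ^ j * a ∈ F.N (n + j) → a ∈ F.N n from
    fun n _ a ha => main n 1 a (by simpa using ha)
  intro n
  induction n with
  | zero => simp [h0]
  | succ n ih =>
    intro j a ha
    have hya : y ^ N * a ∈ F.N (n + 1 + N) := by
      refine hxN.mem_of_pow_mul_mem (j := j) (Nat.le_add_left _ _) ?_
      rw [mul_left_comm, add_right_comm]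
      exact pow_mul_mem_filtration F hy ha N
    obtain ⟨f, hf, w, hw, rfl⟩ := Submodule.mem_sup.1
      (hyx.mem_of_pow_mul_mem (n.succ.zero_le) (Ideal.mem_sup_left hya))
    obtain ⟨b, rfl⟩ := Ideal.mem_span_singleton'.1 hw
    have hb : b ∈ F.N n := by
      refine ih (j + 1) b ?_
      have hbx : x ^ (j + 1) * b = x ^ j * (f + b * x) - x ^ j * f := by ring
      rw [hbx, show n + (j + 1) = n + 1 + j by omega]
      exact sub_mem ha (pow_mul_mem_filtration F hx hf j)
    refine add_mem hf ?_
    simpa [mul_comm] using pow_mul_mem_filtration F hx hb 1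

end Filtration

section SuperficialRegular

variable {A : Type*} [CommRing A] [IsNoetherianRing A] {I : Ideal A} {x : A}

theorem IsSuperficial.isSMulRegular [IsLocalRing A] (hx : IsSuperficial I x) (hI : I ≠ ⊤)
    {y : A} (hyI : y ∈ I) (hy : IsSMulRegular A y) : IsSMulRegular A x := by
  obtain ⟨-, c, hc⟩ := isSuperficial_iff.1 hx
  refine .of_right_eq_zero_of_smul fun a ha => ?_
  refine (hy.pow c).right_eq_zero_of_smul ((Submodule.mem_bot A).1 ?_)
  rw [← Ideal.iInf_pow_eq_bot_of_isLocalRing I hI, Submodule.mem_iInf]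
  have hpow : ∀ n, y ^ c * a ∈ I ^ (n + c) := fun n =>
    hc _ (Nat.le_add_left c n) _ (Ideal.mul_mem_right _ _ (Ideal.pow_mem_pow hyI c))
      (by rw [mul_left_comm, ← smul_eq_mul x, ha, mul_zero]; exact zero_mem _)
  exact fun n => Ideal.pow_le_pow_right (Nat.le_add_right n c) (hpow n)

theorem exists_forall_mem_pow_of_mul_mem_pow (I : Ideal A) (hx : IsSMulRegular A x) :
    ∃ k : ℕ, ∀ n a, x * a ∈ I ^ (n + k) → a ∈ I ^ n := by
  obtain ⟨k, hk⟩ := Ideal.exists_pow_inf_eq_pow_smul I (Ideal.span {x})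
  refine ⟨k, fun n a ha => ?_⟩
  have hmem : x * a ∈ (I ^ (n + k) • ⊤ ⊓ Ideal.span {x} : Ideal A) :=
    ⟨by simpa using ha, Ideal.mul_mem_right _ _ (Ideal.mem_span_singleton_self x)⟩
  rw [hk _ (Nat.le_add_left k n), Nat.add_sub_cancel] at hmem
  obtain ⟨b, hb, hba⟩ := Ideal.mem_span_singleton_mul.1
    ((mul_comm (I ^ n) (Ideal.span {x})).le (Ideal.mul_mono_right inf_le_right hmem))
  rwa [← hx hba]

theorem IsSuperficial.exists_isGrRegularFrom (hx : IsSuperficial I x) (hreg : IsSMulRegular A x) :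
    ∃ N, IsGrRegularFrom (adicFiltration I) x N := by
  obtain ⟨-, c, hc⟩ := isSuperficial_iff.1 hx
  obtain ⟨k, hk⟩ := exists_forall_mem_pow_of_mul_mem_pow I hreg
  exact ⟨c + k, fun n hn a ha => hc n (by omega) a
    (hk c a (Ideal.pow_le_pow_right (by omega) ha)) ha⟩

end SuperficialRegular

section SuperficialSequence

variable {R : Type*} [CommRing R]

theorem isSMulRegular_quotient_mk_iff {K : Ideal R} {x : R} :
    IsSMulRegular (R ⧸ K) (Ideal.Quotient.mk K x) ↔ IsSMulRegular (R ⧸ K) x :=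
  isSMulRegular_map _ fun _ => (Algebra.smul_def _ _).symm

theorem initialIdeal_zero {s : ℕ} (x : Fin s → R) : initialIdeal x 0 = ⊥ := by
  simp [initialIdeal]

theorem initialIdeal_succ {s : ℕ} (x : Fin s → R) (i : Fin s) :
    initialIdeal x (i + 1) = initialIdeal x i ⊔ Ideal.span {x i} := by
  rw [initialIdeal, initialIdeal, ← Ideal.span_union]
  congr 1
  ext r
  simp only [Set.mem_ofPred_eq, Set.mem_union, Set.mem_singleton_iff, Nat.lt_succ_iff_lt_or_eq,
    or_and_right, exists_or, Fin.val_inj, exists_eq_left, eq_comm (a := r)]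

theorem initialIdeal_init {s : ℕ} (x : Fin (s + 1) → R) {i : ℕ} (hi : i ≤ s) :
    initialIdeal (Fin.init x : Fin s → R) i = initialIdeal x i := by
  rw [initialIdeal, initialIdeal]
  congr 1
  ext r
  refine ⟨fun ⟨j, hj, hr⟩ => ⟨j.castSucc, hj, hr⟩, fun ⟨j, hj, hr⟩ => ⟨⟨j, by omega⟩, hj, hr⟩⟩

variable {I : Ideal R}

theorem IsSuperficialSequence.initialIdeal_le {s : ℕ} {x : Fin s → R}
    (hx : IsSuperficialSequence I x) (i : ℕ) : initialIdeal x i ≤ I := by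
  refine Ideal.span_le.2 ?_
  rintro _ ⟨j, -, rfl⟩
  exact (hx j).1

theorem isSuperficialSequence_succ_iff {s : ℕ} {x : Fin (s + 1) → R} :
    IsSuperficialSequence I x ↔ IsSuperficialSequence I (Fin.init x : Fin s → R) ∧
      x (Fin.last s) ∈ I ∧ IsSuperficial (I.map (Ideal.Quotient.mk (initialIdeal x s)))
        (Ideal.Quotient.mk (initialIdeal x s) (x (Fin.last s))) := by
  refine Fin.forall_fin_succ'.trans (and_congr_left fun _ => forall_congr' fun i => ?_)
  rw! [initialIdeal_init x i.isLt.le]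
  rfl

theorem IsSuperficialSequence.exists_init_eq [IsLocalRing R] [IsNoetherianRing R]
    [Infinite (ResidueField R)] (hI : I ≠ ⊤) {s : ℕ} {x : Fin s → R}
    (hx : IsSuperficialSequence I x) :
    ∃ z : Fin (s + 1) → R, Fin.init z = x ∧ IsSuperficialSequence I z := by
  set K := initialIdeal x s
  have : Nontrivial (R ⧸ K) :=
    Ideal.Quotient.nontrivial_iff.2 (ne_top_of_le_ne_top hI (hx.initialIdeal_le s))
  have : IsLocalRing (R ⧸ K) :=
    IsLocalRing.of_surjective' (Ideal.Quotient.mk K) Ideal.Quotient.mk_surjective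
  have : IsLocalHom (Ideal.Quotient.mk K) :=
    IsLocalHom.of_surjective _ Ideal.Quotient.mk_surjective
  have : Infinite (ResidueField (R ⧸ K)) :=
    Infinite.of_injective _ (ResidueField.map (Ideal.Quotient.mk K)).injective
  obtain ⟨y, hy⟩ := exists_isSuperficial (I.map (Ideal.Quotient.mk K))
  obtain ⟨y, hyI, rfl⟩ :=
    (Ideal.mem_map_iff_of_surjective _ Ideal.Quotient.mk_surjective).1 hy.1
  have hinit : (Fin.init (Fin.snoc x y : Fin (s + 1) → R) : Fin s → R) = x := Fin.init_snoc _ _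
  refine ⟨Fin.snoc x y, hinit, isSuperficialSequence_succ_iff.2 ?_⟩
  rw [← initialIdeal_init _ le_rfl, hinit, Fin.snoc_last]
  exact ⟨hx, hyI, hy⟩

end SuperficialSequence

section RegularSequence

universe u

variable {R : Type u} [CommRing R] [IsLocalRing R] [IsNoetherianRing R] {I : Ideal R} {d : ℕ}
  {z : Fin d → R}

theorem IsSuperficialSequence.isSMulRegular_of_hasGradeGE (hz : IsSuperficialSequence I z)
    (hI : I ≠ ⊤) {j : Fin d} {n : ℕ} (h : HasGradeGE I (R ⧸ initialIdeal z j) (n + 1)) :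
    IsSMulRegular (R ⧸ initialIdeal z j) (z j) := by
  set K := initialIdeal z j
  have hKI : K ≤ I := hz.initialIdeal_le j
  have : Nontrivial (R ⧸ K) := Ideal.Quotient.nontrivial_iff.2 (ne_top_of_le_ne_top hI hKI)
  have : IsLocalRing (R ⧸ K) :=
    IsLocalRing.of_surjective' (Ideal.Quotient.mk K) Ideal.Quotient.mk_surjective
  have hIK : I.map (Ideal.Quotient.mk K) ≠ ⊤ := by
    rwa [Ne, ← Ideal.comap_eq_top_iff (f := Ideal.Quotient.mk K), Ideal.comap_map_mk hKI]
  obtain ⟨y, hyI, hy⟩ := h.exists_isSMulRegular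
  exact isSMulRegular_quotient_mk_iff.1 <| (hz j).2.isSMulRegular hIK
    (Ideal.mem_map_of_mem _ hyI) (isSMulRegular_quotient_mk_iff.2 hy)

theorem IsSuperficialSequence.isSMulRegular (hz : IsSuperficialSequence I z) (hI : I ≠ ⊤)
    (hgrade : HasGradeGE I R d) (j : Fin d) : IsSMulRegular (R ⧸ initialIdeal z j) (z j) := by
  suffices h : ∀ i ≤ d, HasGradeGE I (R ⧸ initialIdeal z i) (d - i) by
    refine hz.isSMulRegular_of_hasGradeGE hI (n := d - (j + 1)) ?_
    exact (show d - (j + 1) + 1 = d - j by omega) ▸ h j j.isLt.le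
  intro i hi
  induction i with
  | zero =>
    rw [initialIdeal_zero]
    exact hgrade.congr (Submodule.quotEquivOfEqBot ⊥ rfl).symm
  | succ i ih =>
    have h := ih (by omega)
    rw [show d - i = d - (i + 1) + 1 by omega] at h
    rw [initialIdeal_succ z ⟨i, hi⟩]
    exact h.quotient_sup_span (hz.initialIdeal_le i) hI (hz ⟨i, hi⟩).1
      (hz.isSMulRegular_of_hasGradeGE hI (j := ⟨i, hi⟩) h)

theorem exists_maximalIdeal_pow_le_initialIdeal (hdim : ringKrullDim R = d)
    (hz : ∀ j, z j ∈ maximalIdeal R)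
    (hreg : ∀ j : Fin d, IsSMulRegular (R ⧸ initialIdeal z j) (z j)) :
    ∃ M : ℕ, maximalIdeal R ^ M ≤ initialIdeal z d := by
  have hquot : ∀ i ≤ d, ringKrullDim (R ⧸ initialIdeal z i) + i = d := by
    intro i hi
    induction i with
    | zero =>
      rw [initialIdeal_zero, ringKrullDim_eq_of_ringEquiv (RingEquiv.quotientBot R), hdim]
      simp
    | succ i ih =>
      rw [← ih (by omega), ← ringKrullDim_quotient_sup_span_add_one (hz ⟨i, hi⟩) (hreg ⟨i, hi⟩),
        initialIdeal_succ z ⟨i, hi⟩]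
      push_cast
      ring
  have hdim0 : Ring.KrullDimLE 0 (R ⧸ initialIdeal z d) := by
    rw [Ring.krullDimLE_iff]
    exact (ENat.WithBot.add_le_add_natCast_right_iff (c := d)).1
      (by simpa using (hquot d le_rfl).le)
  have : IsArtinianRing (R ⧸ initialIdeal z d) := isArtinianRing_iff_krullDimLE_zero.2 hdim0
  exact exists_maximalIdeal_pow_le_of_isArtinianRing_quotient _

end RegularSequence

section RatliffRushFiltration

variable {R : Type*} [CommRing R] {I : Ideal R}

theorem forall_mul_mem_pow_add {n k : ℕ} {a : R} (ha : ∀ b ∈ I ^ k, a * b ∈ I ^ n) (l : ℕ) :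
    ∀ b ∈ I ^ (l + k), a * b ∈ I ^ (l + n) := by
  intro b hb
  rw [pow_add] at hb ⊢
  refine Submodule.mul_induction_on hb (fun u hu v hv => ?_) fun u v hu hv => ?_
  · rw [mul_left_comm]
    exact Ideal.mul_mem_mul hu (ha v hv)
  · rw [mul_add]
    exact add_mem hu hv

theorem mem_ratliffRush_pow_iff {n : ℕ} {a : R} :
    a ∈ ratliffRush (I ^ n) ↔ ∃ k, ∀ b ∈ I ^ k, a * b ∈ I ^ (n + k) := by
  rw [mem_ratliffRush]
  simp only [← pow_mul]
  constructor
  · rintro ⟨k, -, h⟩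
    exact ⟨n * k, by rwa [add_comm, ← mul_add_one]⟩
  · rintro ⟨k, h⟩
    rcases n.eq_zero_or_pos with rfl | hn
    · exact ⟨1, le_rfl, by simp⟩
    obtain ⟨l, hl⟩ : ∃ l, n * (k + 1) = l + k :=
      Nat.exists_eq_add_of_le' (by nlinarith)
    refine ⟨k + 1, by omega, ?_⟩
    rw [mul_add_one n (k + 1), hl, add_assoc, add_comm k n]
    exact forall_mul_mem_pow_add h l

theorem ratliffRush_pow_zero (I : Ideal R) : ratliffRush (I ^ 0) = ⊤ :=
  (Ideal.eq_top_iff_one _).2 (mem_ratliffRush_pow_iff.2 ⟨0, by simp⟩)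

theorem pow_le_ratliffRush (I : Ideal R) (n : ℕ) : I ^ n ≤ ratliffRush (I ^ n) :=
  fun _ ha => mem_ratliffRush_pow_iff.2 ⟨0, fun _ _ => Ideal.mul_mem_right _ _ ha⟩

/-- The Ratliff–Rush filtration of `I`, formed by the Ratliff–Rush closures of the powers of `I`. -/
def ratliffRushFiltration (I : Ideal R) : I.Filtration R where
  N n := ratliffRush (I ^ n)
  mono n a ha := by
    obtain ⟨k, hk⟩ := mem_ratliffRush_pow_iff.1 ha
    exact mem_ratliffRush_pow_iff.2
      ⟨k, fun b hb => Ideal.pow_le_pow_right (by omega) (hk b hb)⟩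
  smul_le n := Ideal.mul_le.2 fun x hx a ha => by
    obtain ⟨k, hk⟩ := mem_ratliffRush_pow_iff.1 ha
    refine mem_ratliffRush_pow_iff.2 ⟨k, fun b hb => ?_⟩
    rw [mul_assoc, add_right_comm, pow_succ']
    exact Ideal.mul_mem_mul hx (hk b hb)

theorem ratliffRush_pow_eq {x : R} {N : ℕ} (hx : x ∈ I)
    (h : IsGrRegularFrom (adicFiltration I) x N) {n : ℕ} (hn : N ≤ n) :
    ratliffRush (I ^ n) = I ^ n := by
  refine le_antisymm (fun a ha => ?_) (pow_le_ratliffRush I n)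
  obtain ⟨k, hk⟩ := mem_ratliffRush_pow_iff.1 ha
  refine h.mem_of_pow_mul_mem hn (j := k) ?_
  rw [mul_comm]
  exact hk _ (Ideal.pow_mem_pow hx k)

theorem IsGrRegularFrom.ratliffRushFiltration {x : R} {N : ℕ}
    (h : IsGrRegularFrom (adicFiltration I) x N) :
    IsGrRegularFrom (ratliffRushFiltration I) x 0 := by
  intro n _ a ha
  obtain ⟨k, hk⟩ := mem_ratliffRush_pow_iff.1 ha
  refine mem_ratliffRush_pow_iff.2 ⟨N + k, fun b hb => h (n + (N + k)) (by omega) _ ?_⟩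
  rw [← mul_assoc, show n + (N + k) + 1 = N + (n + 1 + k) by omega]
  exact forall_mul_mem_pow_add hk N b hb

section BehavesWell

variable {s : ℕ} {x : Fin s → R}

theorem RatliffRushBehavesWell.mk_mem_ratliffRush_iff (hx : RatliffRushBehavesWell I x) {n : ℕ}
    {a : R} :
    Ideal.Quotient.mk (initialIdeal x s) a ∈
        ratliffRush (I.map (Ideal.Quotient.mk (initialIdeal x s)) ^ n) ↔
      a ∈ ratliffRush (I ^ n) ⊔ initialIdeal x s := by
  rcases n.eq_zero_or_pos with rfl | hn
  · simp only [ratliffRush_pow_zero, top_sup_eq, Submodule.mem_top]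
  · rw [← Ideal.map_pow, ← hx n hn, ← Ideal.mem_comap,
      Ideal.comap_map_of_surjective' _ Ideal.Quotient.mk_surjective, Ideal.mk_ker]

theorem RatliffRushBehavesWell.isGrRegularFrom (hx : RatliffRushBehavesWell I x) {y : R} {N : ℕ}
    (hy : IsGrRegularFrom (modFiltration (adicFiltration I) (initialIdeal x s)) y N) :
    IsGrRegularFrom (modFiltration (ratliffRushFiltration I) (initialIdeal x s)) y 0 := by
  intro n _ a ha
  have hreg := (isGrRegularFrom_adicFiltration_map_iff.2 hy).ratliffRushFiltration
  refine hx.mk_mem_ratliffRush_iff.1 (hreg n n.zero_le _ ?_)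
  rw [← map_mul]
  exact hx.mk_mem_ratliffRush_iff.2 ha

end BehavesWell

section Descent

variable [IsNoetherianRing R] {s : ℕ} {z : Fin s → R}

theorem IsSuperficialSequence.exists_isGrRegularFrom (hz : IsSuperficialSequence I z) {j : Fin s}
    (hreg : IsSMulRegular (R ⧸ initialIdeal z j) (z j)) :
    ∃ N, IsGrRegularFrom (modFiltration (adicFiltration I) (initialIdeal z j)) (z j) N := by
  obtain ⟨N, hN⟩ := (hz j).2.exists_isGrRegularFrom (isSMulRegular_quotient_mk_iff.2 hreg)
  exact ⟨N, isGrRegularFrom_adicFiltration_map_iff.1 hN⟩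

theorem IsSuperficialSequence.exists_ratliffRush_pow_eq {z : Fin (s + 1) → R}
    (hz : IsSuperficialSequence I z)
    (hreg : IsSMulRegular (R ⧸ initialIdeal z (0 : Fin (s + 1))) (z 0)) :
    ∃ N, ∀ n ≥ N, ratliffRush (I ^ n) = I ^ n := by
  obtain ⟨N, hN⟩ := hz.exists_isGrRegularFrom (j := 0) hreg
  have hadic : modFiltration (adicFiltration I) (initialIdeal z (0 : Fin (s + 1))) =
      adicFiltration I :=
    Ideal.Filtration.ext (funext fun n => by
      exact (congrArg (I ^ n ⊔ ·) (initialIdeal_zero z)).trans (sup_bot_eq _))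
  exact ⟨N, fun n hn => ratliffRush_pow_eq (hz 0).1 (hadic ▸ hN) hn⟩

theorem IsSuperficialSequence.isGrRegularFrom_ratliffRushFiltration {z : Fin (s + 1) → R}
    (hz : IsSuperficialSequence I z)
    (hreg : ∀ j : Fin (s + 1), IsSMulRegular (R ⧸ initialIdeal z j) (z j))
    (hwell : RatliffRushBehavesWell I (Fin.init z : Fin s → R)) (j : Fin (s + 1)) :
    IsGrRegularFrom (modFiltration (ratliffRushFiltration I) (initialIdeal z j)) (z j) 0 := by
  induction j using Fin.reverseInduction with
  | last =>
    obtain ⟨N, hN⟩ := hz.exists_isGrRegularFrom (hreg (Fin.last s))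
    rw [Fin.val_last, ← initialIdeal_init z le_rfl] at hN ⊢
    exact hwell.isGrRegularFrom hN
  | cast j ih =>
    obtain ⟨N, hN⟩ := hz.exists_isGrRegularFrom (hreg j.castSucc)
    obtain ⟨N', hN'⟩ := hz.exists_ratliffRush_pow_eq (hreg 0)
    have h0 : (modFiltration (ratliffRushFiltration I) (initialIdeal z j.castSucc)).N 0 = ⊤ := by
      change ratliffRush (I ^ 0) ⊔ _ = ⊤
      rw [ratliffRush_pow_zero, top_sup_eq]
    have heq : ∀ n ≥ N', (modFiltration (ratliffRushFiltration I)
        (initialIdeal z j.castSucc)).N n =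
        (modFiltration (adicFiltration I) (initialIdeal z j.castSucc)).N n :=
      fun n hn => congrArg (· ⊔ initialIdeal z j.castSucc) (hN' n hn)
    refine IsGrRegularFrom.of_modFiltration_span (N := max N N') h0 (hz j.castSucc).1
      (hz j.succ).1 (fun n hn a ha => ?_) ?_
    · rw [heq _ (by omega)] at ha ⊢
      exact hN n (by omega) a ha
    · rwa [← modFiltration_sup, ← initialIdeal_succ z j.castSucc]

end Descent

end RatliffRushFiltration

section Colength

variable {R : Type*} [CommRing R]

/-- The length of `R ⧸ J` as a natural number, with the junk value `0` if the length is
infinite. -/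
noncomputable def colength (J : Ideal R) : ℕ :=
  (Module.length R (R ⧸ J)).toNat

theorem length_quotient_anti {J J' : Ideal R} (h : J ≤ J') :
    Module.length R (R ⧸ J') ≤ Module.length R (R ⧸ J) :=
  Module.length_le_of_surjective (Submodule.factor h) (Submodule.factor_surjective h)

theorem length_quotient_ne_top [IsNoetherianRing R] {I J : Ideal R} (hI : I.radical.IsMaximal)
    {n : ℕ} (hJ : I ^ n ≤ J) : Module.length R (R ⧸ J) ≠ ⊤ := by
  have : IsArtinianRing (R ⧸ J) := by
    refine isArtinianRing_iff_krullDimLE_zero.2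
      (Ideal.krullDimLE_zero_quotient_iff_forall_minimalPrimes_isMaximal.2 fun P hP => ?_)
    have hIP : I.radical ≤ P := hP.1.1.radical_le_iff.2 (hP.1.1.le_of_pow_le (hJ.trans hP.1.2))
    exact hI.eq_of_le hP.1.1.ne_top hIP ▸ hI
  rw [Module.length_eq_of_surjective (R := R ⧸ J) (S := R) (M := R ⧸ J)
    Ideal.Quotient.mk_surjective]
  exact Module.length_ne_top

open scoped Pointwise in
theorem length_quotient_eq_add (J : Ideal R) (y : R) :
    Module.length R (R ⧸ J) =
      Module.length R (R ⧸ J.colon {y}) + Module.length R (R ⧸ (J ⊔ Ideal.span {y})) := by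
  let f : R →ₗ[R] R ⧸ J := LinearMap.lsmul R (R ⧸ J) y ∘ₗ J.mkQ
  have hker : LinearMap.ker f = J.colon {y} := by
    ext a
    rw [LinearMap.mem_ker, Submodule.mem_colon_singleton, smul_eq_mul, mul_comm]
    exact Submodule.Quotient.mk_eq_zero J
  have hrange : LinearMap.range f = y • (⊤ : Submodule R (R ⧸ J)) := by
    rw [LinearMap.range_comp, Submodule.range_mkQ]
    rfl
  rw [Module.length_eq_add_of_exact f.range.subtype f.range.mkQ f.range.subtype_injective
      f.range.mkQ_surjective (LinearMap.exact_subtype_mkQ _),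
    ← f.quotKerEquivRange.length_eq, hker, hrange, (quotSMulTopQuotientEquiv J y).length_eq]

theorem colength_eq_add {J : Ideal R} (hJ : Module.length R (R ⧸ J) ≠ ⊤) (y : R) :
    colength J = colength (J.colon {y}) + colength (J ⊔ Ideal.span {y}) := by
  have h := length_quotient_eq_add J y
  rw [h] at hJ
  obtain ⟨hcolon, hsup⟩ := WithTop.add_ne_top.1 hJ
  rw [colength, h, ENat.toNat_add hcolon hsup, colength, colength]

theorem colength_span_mul_sup {K G : Ideal R} {y : R} (hy : IsSMulRegular (R ⧸ K) y)
    (hK : K ≤ G) (hfin : Module.length R (R ⧸ (Ideal.span {y} * G ⊔ K)) ≠ ⊤) :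
    colength (Ideal.span {y} * G ⊔ K) = colength G + colength (K ⊔ Ideal.span {y}) := by
  rw [colength_eq_add hfin y]
  have hcolon : (Ideal.span {y} * G ⊔ K).colon {y} = G := by
    ext a
    rw [Submodule.mem_colon_singleton, smul_eq_mul, mul_comm a y]
    refine ⟨fun ha => ?_, fun ha => Ideal.mem_sup_left
      (Ideal.mul_mem_mul (Ideal.mem_span_singleton_self y) ha)⟩
    obtain ⟨w, hw, k, hk, hwk⟩ := Submodule.mem_sup.1 ha
    obtain ⟨g, hg, rfl⟩ := Ideal.mem_span_singleton_mul.1 hw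
    have hag : a - g ∈ K := by
      refine (isSMulRegular_quotient_iff_mem_of_smul_mem K y).1 hy _ ?_
      rwa [smul_eq_mul, mul_sub, ← hwk, add_sub_cancel_left]
    exact (sub_add_cancel a g) ▸ add_mem (hK hag) hg
  rw [hcolon, sup_assoc, sup_eq_right.2 (Ideal.mul_le_left.trans le_sup_right)]

theorem fwdDiff_iter_colength {I : Ideal R} {F : I.Filtration R} {t : ℕ} {z : Fin t → R}
    (hfin : ∀ n, Module.length R (R ⧸ F.N n) ≠ ⊤) (hzI : ∀ j, z j ∈ I)
    (hz : ∀ j : Fin t, IsGrRegularFrom (modFiltration F (initialIdeal z j)) (z j) 0) (n : ℕ) :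
    (fwdDiff 1)^[t] (fun n => (colength (F.N n) : ℚ)) n =
      colength ((modFiltration F (initialIdeal z t)).N (n + t)) := by
  suffices h : ∀ j ≤ t, ∀ n, (fwdDiff 1)^[j] (fun n => (colength (F.N n) : ℚ)) n =
      colength ((modFiltration F (initialIdeal z j)).N (n + j)) from h t le_rfl n
  intro j hj
  induction j with
  | zero =>
    intro n
    change (colength (F.N n) : ℚ) = colength (F.N n ⊔ initialIdeal z 0)
    rw [initialIdeal_zero, sup_bot_eq]
  | succ j ih =>
    intro n
    set G := modFiltration F (initialIdeal z j)
    have hcolon : (G.N (n + j + 1)).colon {z ⟨j, hj⟩} = G.N (n + j) := by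
      ext a
      rw [Submodule.mem_colon_singleton, smul_eq_mul, mul_comm a]
      refine ⟨hz ⟨j, hj⟩ _ (Nat.zero_le _) a, fun ha => ?_⟩
      simpa using pow_mul_mem_filtration G (hzI ⟨j, hj⟩) ha 1
    have hne : Module.length R (R ⧸ G.N (n + j + 1)) ≠ ⊤ :=
      ne_top_of_le_ne_top (hfin _) (length_quotient_anti le_sup_left)
    rw [Function.iterate_succ_apply', fwdDiff, ih (by omega), ih (by omega), add_right_comm,
      colength_eq_add hne (z ⟨j, hj⟩), hcolon, initialIdeal_succ z ⟨j, hj⟩, modFiltration_sup]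
    simp [add_assoc, modFiltration, G]

end Colength

section ForwardDifference

theorem fwdDiff_iter_congr_of_ge {A : Type*} [AddCommGroup A] {f g : ℕ → A} {N : ℕ}
    (h : ∀ n ≥ N, f n = g n) (i : ℕ) :
    ∀ n ≥ N, (fwdDiff 1)^[i] f n = (fwdDiff 1)^[i] g n := by
  induction i with
  | zero => exact h
  | succ i ih =>
    intro n hn
    rw [Function.iterate_succ_apply', Function.iterate_succ_apply', fwdDiff, fwdDiff, ih n hn,
      ih (n + 1) (by omega)]

theorem fwdDiff_iter_eq_zero_of_ge {A : Type*} [AddCommGroup A] {f : ℕ → A} {d N : ℕ}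
    (h : ∀ n ≥ N, (fwdDiff 1)^[d] f n = 0) {k : ℕ} (hk : d ≤ k) :
    ∀ n ≥ N, (fwdDiff 1)^[k] f n = 0 := by
  intro n hn
  rw [← Nat.sub_add_cancel hk, Function.iterate_add_apply,
    fwdDiff_iter_congr_of_ge (g := fun _ => 0) h _ n hn,
    Function.iterate_fixed (fwdDiff_const 1 (0 : A))]

theorem fwdDiff_iter_sub {A : Type*} [AddCommGroup A] (f g : ℕ → A) (i : ℕ) :
    (fwdDiff 1)^[i] (f - g) = (fwdDiff 1)^[i] f - (fwdDiff 1)^[i] g := by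
  rw [eq_sub_iff_add_eq, ← fwdDiff_iter_add, sub_add_cancel]

theorem nonneg_of_fwdDiff_nonpos {A : Type*} [AddCommGroup A] [PartialOrder A]
    [IsOrderedAddMonoid A] {u : ℕ → A} {N ρ : ℕ} (hu : ∀ n ≥ ρ, fwdDiff 1 u n ≤ 0)
    (hzero : ∀ n ≥ N, u n = 0) {n : ℕ} (hn : ρ ≤ n) : 0 ≤ u n := by
  have hanti : AntitoneOn u (Set.Ici ρ) :=
    antitoneOn_nat_Ici_of_succ_le fun m hm => sub_nonpos.1 (hu m hm)
  rw [← hzero (n + N) (by omega)]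
  exact hanti hn (hn.trans (n.le_add_right N)) (n.le_add_right N)

theorem fwdDiff_iter_alternating {A : Type*} [CommRing A] [PartialOrder A] [IsOrderedRing A]
    {u : ℕ → A} {d N ρ : ℕ} (hzero : ∀ n ≥ N, u n = 0)
    (hnonneg : ∀ n ≥ ρ, 0 ≤ (fwdDiff 1)^[d] u n) {i : ℕ} (hi : i ≤ d) :
    ∀ n ≥ ρ, 0 ≤ (-1 : A) ^ (d - i) * (fwdDiff 1)^[i] u n := by
  induction hi using Nat.decreasingInduction with
  | self => simpa only [Nat.sub_self, pow_zero, one_mul] using hnonneg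
  | of_succ i hi ih =>
    intro n hn
    refine nonneg_of_fwdDiff_nonpos (u := (-1 : A) ^ (d - i) • (fwdDiff 1)^[i] u) (N := N)
      (fun m hm => ?_) (fun m hm => ?_) hn
    · have := ih m hm
      rw [Function.iterate_succ_apply'] at this
      rw [fwdDiff_const_smul, Pi.smul_apply, smul_eq_mul, show d - i = d - (i + 1) + 1 by omega,
        pow_succ', neg_one_mul, neg_mul]
      exact neg_nonpos.2 this
    · rw [Pi.smul_apply, fwdDiff_iter_eq_zero_of_ge (d := 0) hzero i.zero_le m hm, smul_zero]

variable {K : Type*} [Field K] [CharZero K]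

theorem fwdDiff_iter_eval_eq_of_eventually_eq {P : K[X]} {d N : ℕ} {e : K}
    (h : ∀ n ≥ N, (fwdDiff 1)^[d] (fun k : ℕ => P.eval (k : K)) n = e) (n : ℕ) :
    (fwdDiff 1)^[d] (fun k : ℕ => P.eval (k : K)) n = e := by
  have hpoly (d : ℕ) : ∃ Q : K[X], ∀ n : ℕ,
      (fwdDiff 1)^[d] (fun k : ℕ => P.eval (k : K)) n = Q.eval (n : K) := by
    induction d with
    | zero => exact ⟨P, fun _ => rfl⟩
    | succ d ih =>
      obtain ⟨Q, hQ⟩ := ih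
      refine ⟨Q.comp (X + 1) - Q, fun n => ?_⟩
      rw [Function.iterate_succ_apply', fwdDiff, hQ, hQ]
      simp
  obtain ⟨Q, hQ⟩ := hpoly d
  have hQe : Q = C e := by
    refine Polynomial.eq_of_infinite_eval_eq _ _
      (((Set.Ici_infinite N).image (Nat.cast_injective (R := K)).injOn).mono ?_)
    rintro _ ⟨n, hn, rfl⟩
    rw [Set.mem_ofPred_eq, ← hQ, h n hn, eval_C]
  rw [hQ, hQe, eval_C]

theorem eq_sum_range_fwdDiff_iter_of_eq_zero {A : Type*} [AddCommGroup A] {f : ℕ → A} {d N : ℕ}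
    (h : ∀ n ≥ N, (fwdDiff 1)^[d] f n = 0) (m : ℕ) :
    f (N + m) = ∑ k ∈ Finset.range d, m.choose k • (fwdDiff 1)^[k] f N := by
  have hnewton := shift_eq_sum_fwdDiff_iter 1 f m N
  rw [smul_eq_mul, mul_one] at hnewton
  rw [hnewton, Finset.sum_subset (Finset.range_mono (Nat.le_add_left (m + 1) d)),
    Finset.sum_subset (Finset.range_mono (Nat.le_add_right d (m + 1)))]
  · intro k _ hk
    rw [fwdDiff_iter_eq_zero_of_ge h (by simpa using hk) N le_rfl, smul_zero]
  · intro k _ hk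
    rw [Nat.choose_eq_zero_of_lt (by simpa using hk), zero_smul]

theorem exists_polynomial_of_fwdDiff_iter_eq_zero {f : ℕ → K} {d N : ℕ}
    (h : ∀ n ≥ N, (fwdDiff 1)^[d] f n = 0) : ∃ P : K[X], ∀ n ≥ N, P.eval (n : K) = f n := by
  refine ⟨∑ k ∈ Finset.range d,
    C ((fwdDiff 1)^[k] f N / k.factorial) * (descPochhammer K k).comp (X - C (N : K)),
    fun n hn => ?_⟩
  obtain ⟨m, rfl⟩ := Nat.exists_eq_add_of_le hn
  rw [eq_sum_range_fwdDiff_iter_of_eq_zero h, eval_finsetSum]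
  refine Finset.sum_congr rfl fun k _ => ?_
  have hk : (k.factorial : K) ≠ 0 := by exact_mod_cast k.factorial_ne_zero
  rw [eval_mul, eval_C, eval_comp, eval_sub, eval_X, eval_C, Nat.cast_add, add_sub_cancel_left,
    descPochhammer_eval_eq_descFactorial, Nat.descFactorial_eq_factorial_mul_choose, nsmul_eq_mul,
    Nat.cast_mul]
  field_simp

theorem exists_polynomial_of_fwdDiff_iter_eq {f : ℕ → K} {d N : ℕ} {e : K}
    (h : ∀ n ≥ N, (fwdDiff 1)^[d] f n = e) : ∃ P : K[X], ∀ n ≥ N, P.eval (n : K) = f n := by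
  refine exists_polynomial_of_fwdDiff_iter_eq_zero (d := d + 1) fun n hn => ?_
  rw [Function.iterate_succ_apply', fwdDiff, h n hn, h (n + 1) (by omega), sub_self]

theorem fwdDiff_iter_eval_sub_alternating [PartialOrder K] [IsOrderedRing K] {f : ℕ → K} {P : K[X]}
    {d N ρ : ℕ} {e : K} (hP : ∀ n ≥ N, P.eval (n : K) = f n)
    (hle : ∀ n ≥ ρ, (fwdDiff 1)^[d] f n ≤ e) (heq : ∀ n ≥ N, (fwdDiff 1)^[d] f n = e)
    {i : ℕ} (hi : i ≤ d) {n : ℕ} (hn : ρ ≤ n) :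
    0 ≤ (-1 : K) ^ (d - i) * (fwdDiff 1)^[i] (fun k : ℕ => P.eval (k : K) - f k) n := by
  have hPe : ∀ n, (fwdDiff 1)^[d] (fun k : ℕ => P.eval (k : K)) n = e :=
    fwdDiff_iter_eval_eq_of_eventually_eq fun n hn => by
      rw [fwdDiff_iter_congr_of_ge hP d n hn, heq n hn]
  refine fwdDiff_iter_alternating (fun n hn => sub_eq_zero.2 (hP n hn)) (fun n hn => ?_) hi n hn
  change 0 ≤ (fwdDiff 1)^[d] ((fun k : ℕ => P.eval (k : K)) - f) n
  rw [fwdDiff_iter_sub, Pi.sub_apply, hPe]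
  exact sub_nonneg.2 (hle n hn)

end ForwardDifference

theorem stabilityIndex_spec {R : Type*} [CommRing R] {I : Ideal R}
    (h : ∃ N, ∀ n ≥ N, ratliffRush (I ^ n) = I ^ n) :
    ∀ n ≥ stabilityIndex I, ratliffRush (I ^ n) = I ^ n := by
  obtain ⟨N, hN⟩ := h
  exact (Nat.sInf_mem (s := {i : ℕ | 1 ≤ i ∧ ∀ n ≥ i, ratliffRush (I ^ n) = I ^ n})
    ⟨N + 1, by omega, fun n hn => hN n (by omega)⟩).2

section DimensionOne

variable {R : Type*} [CommRing R] {I K : Ideal R} {y : R}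

theorem IsGrRegularFrom.exists_pow_succ_le {N M : ℕ}
    (hy : IsGrRegularFrom (modFiltration (adicFiltration I) K) y N)
    (hM : I ^ M ≤ K ⊔ Ideal.span {y}) :
    ∃ N', ∀ n ≥ N', I ^ (n + 1) ≤ Ideal.span {y} * (I ^ n ⊔ K) ⊔ K := by
  refine ⟨max N M, fun n hn a ha => ?_⟩
  obtain ⟨k, hk, w, hw, rfl⟩ := Submodule.mem_sup.1 (hM (Ideal.pow_le_pow_right (by omega) ha))
  obtain ⟨b, rfl⟩ := Ideal.mem_span_singleton.1 hw
  have hyb : y * b ∈ I ^ (n + 1) ⊔ K :=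
    (Submodule.add_mem_iff_right _ (Ideal.mem_sup_right hk)).1 (Ideal.mem_sup_left ha)
  exact add_mem (Ideal.mem_sup_right hk) (Ideal.mem_sup_left
    (Ideal.mul_mem_mul (Ideal.mem_span_singleton_self y) (hy n (by omega) b hyb)))

theorem span_mul_modFiltration_sup_le (F : I.Filtration R) (hy : y ∈ I) (n : ℕ) :
    Ideal.span {y} * (modFiltration F K).N n ⊔ K ≤ (modFiltration F K).N (n + 1) := by
  refine sup_le (Ideal.span_singleton_mul_le_iff.2 fun a ha => ?_) le_sup_right
  simpa using pow_mul_mem_filtration (modFiltration F K) hy ha 1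

/-- `hred` says that `y` generates a reduction of the image of `F` in `R ⧸ K`, so that
`λ(R / (K + (y)))` is its multiplicity. -/
theorem fwdDiff_colength_modFiltration_le_and_eventually_eq {F : I.Filtration R} (hyI : y ∈ I)
    (hy : IsSMulRegular (R ⧸ K) y)
    (hfin : ∀ n, Module.length R (R ⧸ (Ideal.span {y} * (modFiltration F K).N n ⊔ K)) ≠ ⊤) {N : ℕ}
    (hred : ∀ n ≥ N, (modFiltration F K).N (n + 1) ≤
      Ideal.span {y} * (modFiltration F K).N n ⊔ K) :
    (∀ n, fwdDiff 1 (fun n => (colength ((modFiltration F K).N n) : ℚ)) n ≤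
      colength (K ⊔ Ideal.span {y})) ∧
    ∀ n ≥ N, fwdDiff 1 (fun n => (colength ((modFiltration F K).N n) : ℚ)) n =
      colength (K ⊔ Ideal.span {y}) := by
  have hstep (n : ℕ) : (colength (Ideal.span {y} * (modFiltration F K).N n ⊔ K) : ℚ) =
      colength ((modFiltration F K).N n) + colength (K ⊔ Ideal.span {y}) := by
    exact_mod_cast colength_span_mul_sup hy le_sup_right (hfin n)
  refine ⟨fun n => ?_, fun n hn => ?_⟩
  · rw [fwdDiff, sub_le_iff_le_add', ← hstep]
    exact_mod_cast ENat.toNat_le_toNat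
      (length_quotient_anti (span_mul_modFiltration_sup_le F hyI n)) (hfin n)
  · rw [fwdDiff, sub_eq_iff_eq_add', ← hstep,
      le_antisymm (hred n hn) (span_mul_modFiltration_sup_le F hyI n)]

end DimensionOne

section Difference

variable {R : Type*} [CommRing R] [IsNoetherianRing R] {I : Ideal R} {s : ℕ}

theorem IsSuperficialSequence.fwdDiff_iter_colength_ratliffRush {z : Fin (s + 1) → R}
    (hz : IsSuperficialSequence I z) (hI : I.radical.IsMaximal)
    (hreg : ∀ j : Fin (s + 1), IsSMulRegular (R ⧸ initialIdeal z j) (z j))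
    (hwell : RatliffRushBehavesWell I (Fin.init z : Fin s → R)) (n : ℕ) :
    (fwdDiff 1)^[s + 1] (fun n => (colength (ratliffRush (I ^ n)) : ℚ)) n =
      colength ((modFiltration (ratliffRushFiltration I) (initialIdeal z (s + 1))).N
        (n + (s + 1))) :=
  fwdDiff_iter_colength (F := ratliffRushFiltration I)
    (fun n => length_quotient_ne_top hI (pow_le_ratliffRush I n)) (fun j => (hz j).1)
    (hz.isGrRegularFrom_ratliffRushFiltration hreg hwell) n

variable [IsLocalRing R]

theorem IsSuperficialSequence.exists_pow_succ_le {z : Fin (s + 1) → R}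
    (hz : IsSuperficialSequence I z) (hI : I.radical = maximalIdeal R)
    (hdim : ringKrullDim R = (s + 1 : ℕ))
    (hreg : ∀ j : Fin (s + 1), IsSMulRegular (R ⧸ initialIdeal z j) (z j)) :
    ∃ N, ∀ n ≥ N, I ^ (n + 1) ≤
      Ideal.span {z (Fin.last s)} * (I ^ n ⊔ initialIdeal z s) ⊔ initialIdeal z s := by
  have hIm : I ≤ maximalIdeal R := hI ▸ Ideal.le_radical
  obtain ⟨M, hM⟩ := exists_maximalIdeal_pow_le_initialIdeal hdim (fun j => hIm (hz j).1) hreg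
  obtain ⟨N, hN⟩ := hz.exists_isGrRegularFrom (hreg (Fin.last s))
  refine hN.exists_pow_succ_le (M := M) ?_
  exact ((Ideal.pow_right_mono hIm M).trans hM).trans_eq (initialIdeal_succ z (Fin.last s))

theorem IsSuperficialSequence.exists_fwdDiff_iter_colength_ratliffRush_le {z : Fin (s + 2) → R}
    (hz : IsSuperficialSequence I z) (hI : I.radical = maximalIdeal R)
    (hdim : ringKrullDim R = (s + 2 : ℕ))
    (hreg : ∀ j : Fin (s + 2), IsSMulRegular (R ⧸ initialIdeal z j) (z j))
    (hwell : RatliffRushBehavesWell I (Fin.init (Fin.init z : Fin (s + 1) → R) : Fin s → R)) :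
    ∃ (e : ℚ) (N : ℕ),
      (∀ n, (fwdDiff 1)^[s + 2] (fun n => (colength (ratliffRush (I ^ n)) : ℚ)) n ≤ e) ∧
      ∀ n ≥ N, (fwdDiff 1)^[s + 2] (fun n => (colength (ratliffRush (I ^ n)) : ℚ)) n = e := by
  set K := initialIdeal z (s + 1)
  set y := z (Fin.last (s + 1))
  set G := modFiltration (ratliffRushFiltration I) K
  have hImax : I.radical.IsMaximal := hI ▸ maximalIdeal.isMaximal R
  have hIG : ∀ n, I ^ n ⊔ K ≤ G.N n := fun n => sup_le_sup_right (pow_le_ratliffRush I n) K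
  have hdiff : ∀ n, (fwdDiff 1)^[s + 2] (fun n => (colength (ratliffRush (I ^ n)) : ℚ)) n =
      fwdDiff 1 (fun n => (colength (G.N n) : ℚ)) (n + (s + 1)) := by
    have h := (isSuperficialSequence_succ_iff.1 hz).1.fwdDiff_iter_colength_ratliffRush hImax
      (fun j => by rw [initialIdeal_init z j.isLt.le]; exact hreg j.castSucc) hwell
    rw [initialIdeal_init z le_rfl] at h
    intro n
    rw [Function.iterate_succ_apply', fwdDiff, fwdDiff, add_right_comm, ← h, ← h]
  obtain ⟨N, hN⟩ := hz.exists_pow_succ_le hI hdim hreg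
  obtain ⟨N', hN'⟩ := hz.exists_ratliffRush_pow_eq (hreg 0)
  have hfin : ∀ n, Module.length R (R ⧸ (Ideal.span {y} * G.N n ⊔ K)) ≠ ⊤ := by
    refine fun n => length_quotient_ne_top hImax (n := n + N + 1) ((hN _ (by omega)).trans ?_)
    exact sup_le_sup_right (Ideal.mul_mono_right ((sup_le_sup_right
      (Ideal.pow_le_pow_right (Nat.le_add_right n N)) K).trans (hIG n))) K
  have hred : ∀ n ≥ max N N', G.N (n + 1) ≤ Ideal.span {y} * G.N n ⊔ K := by
    refine fun n hn => sup_le ?_ le_sup_right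
    change ratliffRush (I ^ (n + 1)) ≤ _
    rw [hN' _ (by omega)]
    exact (hN n (by omega)).trans (sup_le_sup_right (Ideal.mul_mono_right (hIG n)) K)
  obtain ⟨hle, heq⟩ := fwdDiff_colength_modFiltration_le_and_eventually_eq (hz _).1
    (hreg (Fin.last (s + 1))) hfin hred
  exact ⟨_, max N N', fun n => (hdiff n).trans_le (hle _),
    fun n hn => (hdiff n).trans (heq _ (by omega))⟩

theorem IsSuperficialSequence.exists_fwdDiff_iter_hilbertSamuel_le {z : Fin (s + 2) → R}
    (hz : IsSuperficialSequence I z) (hI : I.radical = maximalIdeal R)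
    (hdim : ringKrullDim R = (s + 2 : ℕ))
    (hreg : ∀ j : Fin (s + 2), IsSMulRegular (R ⧸ initialIdeal z j) (z j))
    (hwell : RatliffRushBehavesWell I (Fin.init (Fin.init z : Fin (s + 1) → R) : Fin s → R)) :
    ∃ (e : ℚ) (N : ℕ),
      (∀ n ≥ stabilityIndex I, (fwdDiff 1)^[s + 2] (fun n => (hilbertSamuel I n : ℚ)) n ≤ e) ∧
      ∀ n ≥ N, (fwdDiff 1)^[s + 2] (fun n => (hilbertSamuel I n : ℚ)) n = e := by
  obtain ⟨e, N, hle, heq⟩ :=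
    hz.exists_fwdDiff_iter_colength_ratliffRush_le hI hdim hreg hwell
  have hstable := stabilityIndex_spec (hz.exists_ratliffRush_pow_eq (hreg 0))
  have hcongr : ∀ n ≥ stabilityIndex I, (fwdDiff 1)^[s + 2] (fun n => (hilbertSamuel I n : ℚ)) n =
      (fwdDiff 1)^[s + 2] (fun n => (colength (ratliffRush (I ^ n)) : ℚ)) n :=
    fwdDiff_iter_congr_of_ge (fun n hn => by rw [hstable n hn]; rfl) (s + 2)
  exact ⟨e, max N (stabilityIndex I), fun n hn => (hcongr n hn).trans_le (hle n),
    fun n hn => (hcongr n (by omega)).trans (heq n (by omega))⟩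

end Difference

theorem theorem5p6 {R : Type*} [CommRing R] [IsLocalRing R]
    [Infinite (ResidueField R)] (hR : IsCohenMacaulayLocal R)
    (d : ℕ) (hd : 2 ≤ d) (hdim : ringKrullDim R = d)
    (I : Ideal R) (hI : I.radical = maximalIdeal R)
    (x : Fin (d - 2) → R) (hx : IsSuperficialSequence I x)
    (hwell : RatliffRushBehavesWell I x) :
    IsHilbertSamuelPoly I (hilbertSamuelPoly I) ∧
      ∀ i : ℕ, i ≤ d → ∀ n : ℕ, stabilityIndex I ≤ n →
        0 ≤ (-1 : ℚ) ^ (d - i) *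
          (fwdDiff 1)^[i]
            (fun k : ℕ => (hilbertSamuelPoly I).eval (k : ℚ) - (hilbertSamuel I k : ℚ)) n := by
  have := hR.1
  obtain ⟨s, rfl⟩ := Nat.exists_eq_add_of_le' hd
  have hItop : I ≠ ⊤ := fun h =>
    (maximalIdeal.isMaximal R).ne_top (by rw [← hI, h, Ideal.radical_top])
  obtain ⟨w, hwx, hw⟩ := IsSuperficialSequence.exists_init_eq (s := s) hItop hx
  obtain ⟨z, rfl, hz⟩ := hw.exists_init_eq hItop
  subst hwx
  have hreg := hz.isSMulRegular hItop (hR.hasGradeGE hdim hI)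
  obtain ⟨e, N, hle, heq⟩ := hz.exists_fwdDiff_iter_hilbertSamuel_le hI hdim hreg hwell
  obtain ⟨P, hP⟩ := exists_polynomial_of_fwdDiff_iter_eq heq
  have hHS : IsHilbertSamuelPoly I P := eventually_atTop.2 ⟨N, hP⟩
  rw [hHS.eq]
  exact ⟨hHS, fun i hi n hn => fwdDiff_iter_eval_sub_alternating hP hle heq hi hn⟩
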